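/- For each integer $n\ge 1$ let $d=d_n$ be a nonnegative integer, let $y=(y_1,\dots,y_n)^\top\in\{\pm1\}^n$ and $\mu\in\mathbb R^{d}$ be deterministic (all may depend on $n$), and let $$x_i=y_i\mu+z_i\in\mathbb R^d,\qquad i=1,\dots,n,$$ where $z_1,\dots,z_n$ are independent, $z_i\sim N(0,\Sigma_i)$, with $\Sigma_1=2I_d$ and $\Sigma_2=\dots=\Sigma_n=I_d$. Let $X=(x_1,\dots,x_n)^\top\in\mathbb R^{n\times d}$ and $\bar X=(y_1\mu,\dots,y_n\mu)^\top=y\mu^\top$. For a square matrix $A$ let $\mathcal H(A)$ be the matrix obtained from $A$ by setting its diagonal entries to zero. A leading eigenvector of a real symmetric matrix is a unit eigenvector for its largest eigenvalue (when it is not unique, any choice is allowed). Let $\hat u$, $u$ and $\bar u$ be leading eigenvectors of $XX^\top$, $\mathcal H(XX^\top)$ and $\bar X\bar X^\top$, respectively (so $\bar u=\pm y/\sqrt n$ whenever $\mu\ne0$). For nonnegative sequences write $a_n\ll b_n$ if $b_n>0$ for all large $n$ and $a_n/b_n\to0$. Suppose that, as $n\to\infty$, $$(d/n)^{1/4}\ll\|\mu\|_2\ll\sqrt{d/n}.$$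 Then, as $n\to\infty$, $|\langle\hat u,\bar u\rangle|\to0$ in probability and $|\langle u,\bar u\rangle|\to1$ in probability. -/

import Mathlib

open MeasureTheory ProbabilityTheory Filter Topology

namespace HollowedPCA

noncomputable section

/-- `a ≪ b` for nonnegative sequences: `b n > 0` (for all large `n`) and `a n / b n → 0`. -/
def MuchLess (a b : ℕ → ℝ) : Prop :=
  (∀ᶠ n in atTop, 0 < b n) ∧ Tendsto (fun n => a n / b n) atTop (𝓝 0)

/-- Convergence in probability of real random variables `Y n`, where `Y n` may live on its own
probability space `(Ω n, P n)`, to a constant `c`. -/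
def TendstoInProb {Ω : ℕ → Type*} [∀ n, MeasurableSpace (Ω n)] (P : ∀ n, Measure (Ω n))
    (Y : ∀ n, Ω n → ℝ) (c : ℝ) : Prop :=
  ∀ ε : ℝ, 0 < ε → Tendsto (fun n => P n {ω | ε ≤ |Y n ω - c|}) atTop (𝓝 0)

/-- The hollowing operator: set all diagonal entries to zero. -/
def hollow {n : ℕ} (A : Matrix (Fin n) (Fin n) ℝ) : Matrix (Fin n) (Fin n) ℝ :=
  Matrix.of fun i j => if i = j then 0 else A i j

/-- `v` is a unit eigenvector of `A` for the largest eigenvalue of `A`. -/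
def IsLeadingEigenvector {n : ℕ} (A : Matrix (Fin n) (Fin n) ℝ)
    (v : EuclideanSpace ℝ (Fin n)) : Prop :=
  ‖v‖ = 1 ∧ ∃ l : ℝ, Module.End.HasEigenvector (Matrix.toEuclideanLin A) l v ∧
    ∀ m : ℝ, Module.End.HasEigenvalue (Matrix.toEuclideanLin A) m → m ≤ l

/-- The `n × d` data matrix whose rows are the vectors `x 0, …, x (n - 1)` of `ℝ^d`. -/
def dataMatrix {n d : ℕ} (x : Fin n → EuclideanSpace ℝ (Fin d)) : Matrix (Fin n) (Fin d) ℝ :=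
  Matrix.of fun i j => x i j

/-- The Gram matrix `X Xᵀ` of the vectors `x i`, where `X` is the data matrix. -/
def gram {n d : ℕ} (x : Fin n → EuclideanSpace ℝ (Fin d)) : Matrix (Fin n) (Fin n) ℝ :=
  dataMatrix x * (dataMatrix x).transpose

/-- The signals `x̄ i = y i • μ`. -/
def signal {n d : ℕ} (y : Fin n → ℝ) (μ : EuclideanSpace ℝ (Fin d)) :
    Fin n → EuclideanSpace ℝ (Fin d) :=
  fun i => y i • μ

/-- The heteroscedastic rank-one Gaussian model: `x i = y i • μ + z i` with deterministic signs
`y i = ±1`, deterministic `μ`, and independent noises `z i ∼ N(0, S i)` with `S i` positive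
definite. -/
structure IsRankOneGaussianModel {n d : ℕ} {Ω : Type*} [MeasurableSpace Ω] (P : Measure Ω)
    (y : Fin n → ℝ) (μ : EuclideanSpace ℝ (Fin d)) (S : Fin n → Matrix (Fin d) (Fin d) ℝ)
    (z x : Fin n → Ω → EuclideanSpace ℝ (Fin d)) : Prop where
  sign : ∀ i, y i = 1 ∨ y i = -1
  posDef : ∀ i, (S i).PosDef
  law : ∀ i, HasLaw (z i) (multivariateGaussian 0 (S i)) P
  indep : iIndepFun z P
  eq : ∀ i ω, x i ω = signal y μ i + z i ω

/-- The covariances `2 I` for the first sample and `I` for all the others. -/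
def firstDoubled (n d : ℕ) : Fin n → Matrix (Fin d) (Fin d) ℝ :=
  fun i => if (i : ℕ) = 0 then (2 : ℝ) • 1 else 1

end

end HollowedPCA

namespace HollowedPCA

/-! ### Concentration of the squared norm of a standard Gaussian vector -/

/-! Write `p = y / √n` and let `Z` have rows `z i`. On the unit sphere the quadratic form of `X Xᵀ`
is `n ‖μ‖² ⟪p, v⟫²`, plus a cross term, plus that of `Z Zᵀ`. With high probability `Z Zᵀ` is `d •
diag (2, 1, …, 1)` up to `O(√(n d))` in operator norm (`measureReal_not_abs_centeredGramForm_le`: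
chi-square tails and a net), and the cross term is `O(n ‖μ‖^(3/2))` (Markov).

The two growth conditions force `‖μ‖ → ∞` and `d / n → ∞`. The upper one makes `n ‖μ‖²` and all
errors `o(d)`, so the form is `d (1 + ⟪e, v⟫²) + o(d)` with `e` the first basis vector: `uhat`
aligns with `e`, and `|⟪e, p⟫| = 1 / √n`. Hollowing removes `d • diag (2, 1, …, 1)` and leaves `n
‖μ‖² ⟪p, v⟫² - ‖μ‖²` up to `O(√(n d) + n ‖μ‖^(3/2))`, which the lower condition makes `o(n ‖μ‖²)`:
`u` aligns with `p`. Both alignments come from `IsLeadingEigenvector.one_sub_inner_sq_le`. -/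

lemma inv_sqrt_mul_exp_neg_le {l : ℝ} (hl : |l| ≤ 1 / 4) :
    (√(1 - 2 * l))⁻¹ * Real.exp (-l) ≤ Real.exp (4 * l ^ 2) := by
  obtain ⟨h1, h2⟩ := abs_le.1 hl
  have hpos : 0 < 1 - 2 * l := by linarith
  have hlog : -2 * l - 8 * l ^ 2 ≤ Real.log (1 - 2 * l) := by
    refine le_trans ?_ (Real.one_sub_inv_le_log_of_pos hpos)
    have : 1 - (1 - 2 * l)⁻¹ = - (2 * l) / (1 - 2 * l) := by field_simp; ring
    rw [this, le_div_iff₀ hpos]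
    -- With the denominator cleared this is `0 ≤ 4 * l ^ 2 * (1 - 4 * l)`, hence the need for `l ≤ 1
    -- / 4`.
    nlinarith [sq_nonneg l, mul_nonneg (sq_nonneg l) (by linarith : (0 : ℝ) ≤ 1 - 4 * l)]
  have hexp : Real.exp (-l - 4 * l ^ 2) ≤ √(1 - 2 * l) := by
    refine Real.le_sqrt_of_sq_le ?_
    rw [← Real.exp_nat_mul, ← Real.le_log_iff_exp_le hpos]
    refine le_trans (le_of_eq ?_) hlog
    push_cast; ring
  rw [inv_mul_le_iff₀ (Real.sqrt_pos.2 hpos)]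
  calc Real.exp (-l) = Real.exp (-l - 4 * l ^ 2) * Real.exp (4 * l ^ 2) := by
        rw [← Real.exp_add]; ring_nf
    _ ≤ _ := by gcongr

lemma gaussianPDFReal_smul_exp_sq (l x : ℝ) :
    gaussianPDFReal 0 1 x • Real.exp (l * (x ^ 2 - 1)) =
      ((√(2 * Real.pi))⁻¹ * Real.exp (-l)) * Real.exp (-(1 / 2 - l) * x ^ 2) := by
  simp only [gaussianPDFReal, NNReal.coe_one, mul_one, sub_zero, smul_eq_mul]
  rw [mul_assoc, mul_assoc, ← Real.exp_add, ← Real.exp_add]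
  ring_nf

lemma integrable_exp_sq_gaussianReal {l : ℝ} (hl : l < 1 / 2) :
    Integrable (fun x ↦ Real.exp (l * (x ^ 2 - 1))) (gaussianReal 0 1) := by
  rw [gaussianReal_of_var_ne_zero _ one_ne_zero, gaussianPDF_def,
    integrable_withDensity_iff_integrable_smul₀' (by fun_prop) (by simp)]
  refine ((integrable_exp_neg_mul_sq (b := 1 / 2 - l) (by linarith)).const_mul
    ((√(2 * Real.pi))⁻¹ * Real.exp (-l))).congr (ae_of_all _ fun x ↦ ?_)
  simp only [ENNReal.toReal_ofReal (gaussianPDFReal_nonneg 0 1 x)]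
  exact (gaussianPDFReal_smul_exp_sq l x).symm

/-- The integral is exactly `(√(1 - 2 * l))⁻¹ * exp (-l)`, the moment generating function of a
centred chi-square variable. -/
lemma integral_exp_sq_gaussianReal_le {l : ℝ} (hl : |l| ≤ 1 / 4) :
    ∫ x, Real.exp (l * (x ^ 2 - 1)) ∂(gaussianReal 0 1) ≤ Real.exp (4 * l ^ 2) := by
  have h2 := (abs_le.1 hl).2
  rw [integral_gaussianReal_eq_integral_smul one_ne_zero]
  simp_rw [gaussianPDFReal_smul_exp_sq]
  rw [integral_const_mul, integral_gaussian]
  refine le_trans (le_of_eq ?_) (inv_sqrt_mul_exp_neg_le hl)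
  have : Real.pi / (1 / 2 - l) = 2 * Real.pi / (1 - 2 * l) := by
    rw [div_eq_div_iff (by linarith) (by linarith)]; ring
  rw [this, Real.sqrt_div (by positivity)]
  have : √(2 * Real.pi) ≠ 0 := by positivity
  field_simp

lemma exp_mul_norm_sq_sub_eq_prod {d : ℕ} (l : ℝ) (x : Fin d → ℝ) :
    Real.exp (l * (‖WithLp.toLp 2 x‖ ^ 2 - d)) = ∏ i, Real.exp (l * (x i ^ 2 - 1)) := by
  rw [← Real.exp_sum, ← Finset.mul_sum, EuclideanSpace.real_norm_sq_eq]
  simp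

lemma integrable_exp_norm_sq_stdGaussian {d : ℕ} {l : ℝ} (hl : l < 1 / 2) :
    Integrable (fun x ↦ Real.exp (l * (‖x‖ ^ 2 - d)))
      (stdGaussian (EuclideanSpace ℝ (Fin d))) := by
  rw [← map_pi_eq_stdGaussian, integrable_map_measure (by fun_prop) (by fun_prop)]
  simp only [Function.comp_def, exp_mul_norm_sq_sub_eq_prod]
  exact Integrable.fintype_prod fun i ↦ integrable_exp_sq_gaussianReal hl

lemma integral_exp_norm_sq_stdGaussian_le {d : ℕ} {l : ℝ} (hl : |l| ≤ 1 / 4) :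
    ∫ x, Real.exp (l * (‖x‖ ^ 2 - d)) ∂(stdGaussian (EuclideanSpace ℝ (Fin d))) ≤
      Real.exp (4 * l ^ 2 * d) := by
  rw [← map_pi_eq_stdGaussian, integral_map (by fun_prop) (by fun_prop)]
  simp only [exp_mul_norm_sq_sub_eq_prod]
  rw [integral_fintype_prod_eq_prod (f := fun _ (y : ℝ) ↦ Real.exp (l * (y ^ 2 - 1)))]
  simp only [Finset.prod_const, Finset.card_univ, Fintype.card_fin]
  rw [mul_comm (4 * l ^ 2), Real.exp_nat_mul]
  exact pow_le_pow_left₀ (integral_nonneg fun x ↦ (Real.exp_pos _).le)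
    (integral_exp_sq_gaussianReal_le hl) d

lemma stdGaussian_real_le_abs_norm_sq_sub {d : ℕ} (hd : 0 < d) {t : ℝ} (ht : 0 ≤ t)
    (htd : t ≤ 2 * d) :
    (stdGaussian (EuclideanSpace ℝ (Fin d))).real {x | t ≤ |‖x‖ ^ 2 - d|} ≤
      2 * Real.exp (-(t ^ 2 / (16 * d))) := by
  have hd' : (0 : ℝ) < d := by exact_mod_cast hd
  -- Chernoff parameter: the minimizer of `4 * l ^ 2 * d - l * t`; `t ≤ 2 * d` says `l ≤ 1 / 4`.
  set l : ℝ := t / (8 * d) with hl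
  have hl0 : 0 ≤ l := by positivity
  have hl4 : l ≤ 1 / 4 := by rw [hl, div_le_iff₀ (by positivity)]; linarith
  have hexp : Real.exp (-(l * t)) * Real.exp (4 * l ^ 2 * d) =
      Real.exp (-(t ^ 2 / (16 * d))) := by
    rw [← Real.exp_add, hl]; congr 1; field_simp; ring
  have hup := measure_ge_le_exp_mul_mgf (X := fun x : EuclideanSpace ℝ (Fin d) ↦ ‖x‖ ^ 2 - d)
    (μ := stdGaussian _) t hl0 (integrable_exp_norm_sq_stdGaussian (by linarith))
  have hlo := measure_le_le_exp_mul_mgf (X := fun x : EuclideanSpace ℝ (Fin d) ↦ ‖x‖ ^ 2 - d)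
    (μ := stdGaussian _) (t := -l) (-t) (by linarith)
    (integrable_exp_norm_sq_stdGaussian (by linarith))
  have h1 := integral_exp_norm_sq_stdGaussian_le (d := d) (l := l) (by rwa [abs_of_nonneg hl0])
  have h2 := integral_exp_norm_sq_stdGaussian_le (d := d) (l := -l)
    (by rwa [abs_neg, abs_of_nonneg hl0])
  have hsub : {x : EuclideanSpace ℝ (Fin d) | t ≤ |‖x‖ ^ 2 - d|} ⊆
      {x | t ≤ ‖x‖ ^ 2 - d} ∪ {x | ‖x‖ ^ 2 - d ≤ -t} := fun x hx ↦ by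
    rcases le_abs.1 (show t ≤ |‖x‖ ^ 2 - d| from hx) with h | h
    · exact Or.inl h
    · exact Or.inr (show ‖x‖ ^ 2 - d ≤ -t by linarith)
  refine (measureReal_mono hsub).trans ((measureReal_union_le _ _).trans ?_)
  have e1 := hup.trans (mul_le_mul_of_nonneg_left h1 (Real.exp_pos _).le)
  have e2 := hlo.trans (mul_le_mul_of_nonneg_left h2 (Real.exp_pos _).le)
  rw [show -l * t = -(l * t) by ring, hexp] at e1
  rw [show - -l * -t = -(l * t) by ring, neg_sq, hexp] at e2
  linarith

/-! ### Linear combinations of independent isotropic Gaussian vectors -/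

lemma charFun_multivariateGaussian_smul_one {d : ℕ} {s : ℝ} (hs : 0 ≤ s)
    (t : EuclideanSpace ℝ (Fin d)) :
    charFun (multivariateGaussian 0 (s • (1 : Matrix (Fin d) (Fin d) ℝ))) t =
      Complex.exp (((-(s * ‖t‖ ^ 2 / 2) : ℝ)) : ℂ) := by
  rw [charFun_multivariateGaussian (Matrix.PosSemidef.one.smul hs)]
  congr 1
  have : t.ofLp ⬝ᵥ (s • (1 : Matrix (Fin d) (Fin d) ℝ)).mulVec t.ofLp = s * ‖t‖ ^ 2 := by
    rw [Matrix.smul_mulVec, Matrix.one_mulVec, dotProduct_smul, EuclideanSpace.real_norm_sq_eq]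
    simp [dotProduct, sq]
  rw [this]
  simp

/-- Characteristic functions multiply over independent summands. Hence the form of `Z Zᵀ` at a fixed
`v` is a multiple of a single chi-square variable, and the tail bound above applies direction by
direction. -/
lemma map_sum_smul_eq_map_stdGaussian {n d : ℕ} {Ω : Type*} [MeasurableSpace Ω] {P : Measure Ω}
    [IsProbabilityMeasure P] {s : Fin n → ℝ} (hs : ∀ i, 0 ≤ s i)
    {z : Fin n → Ω → EuclideanSpace ℝ (Fin d)}
    (law : ∀ i, HasLaw (z i) (multivariateGaussian 0 (s i • 1)) P) (indep : iIndepFun z P)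
    (v : Fin n → ℝ) :
    P.map (fun ω ↦ ∑ i, v i • z i ω) =
      (stdGaussian (EuclideanSpace ℝ (Fin d))).map (fun x ↦ √(∑ i, s i * v i ^ 2) • x) := by
  have hz : ∀ i, AEMeasurable (z i) P := fun i ↦ (law i).aemeasurable
  have := Measure.isProbabilityMeasure_map (μ := P) (f := fun ω ↦ ∑ i, v i • z i ω)
    (by fun_prop)
  have := Measure.isProbabilityMeasure_map (μ := stdGaussian (EuclideanSpace ℝ (Fin d)))
    (f := fun x ↦ √(∑ i, s i * v i ^ 2) • x) (by fun_prop)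
  apply Measure.ext_of_charFun
  have hind : iIndepFun (fun i ω ↦ v i • z i ω) P :=
    indep.comp (fun i x ↦ v i • x) fun i ↦ by fun_prop
  rw [iIndepFun.charFun_map_fun_sum_eq_prod (fun i ↦ by fun_prop) hind]
  ext t
  have hmap : ∀ i, charFun (P.map (fun ω ↦ v i • z i ω)) t =
      Complex.exp (((-(s i * v i ^ 2 * ‖t‖ ^ 2 / 2) : ℝ)) : ℂ) := fun i ↦ by
    have h : P.map (fun ω ↦ v i • z i ω) = (P.map (z i)).map (fun x ↦ v i • x) :=
      (AEMeasurable.map_map_of_aemeasurable (by fun_prop) (hz i)).symm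
    rw [h, charFun_map_smul, (law i).map_eq, charFun_multivariateGaussian_smul_one (hs i),
      norm_smul, mul_pow, Real.norm_eq_abs, sq_abs, mul_assoc]
  rw [Finset.prod_apply, Finset.prod_congr rfl fun i _ ↦ hmap i, charFun_map_smul,
    charFun_stdGaussian, ← Complex.exp_sum, ← Complex.ofReal_pow, norm_smul, mul_pow, Real.norm_eq_abs, sq_abs,
    Real.sq_sqrt (Finset.sum_nonneg fun i _ ↦ mul_nonneg (hs i) (sq_nonneg _)),
    ← Complex.ofReal_sum, Finset.sum_neg_distrib, ← Finset.sum_div, ← Finset.sum_mul]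
  congr 1
  push_cast
  ring

lemma measureReal_lt_abs_norm_sum_smul_sq_sub {n d : ℕ} {Ω : Type*} [MeasurableSpace Ω]
    {P : Measure Ω} [IsProbabilityMeasure P] {s : Fin n → ℝ} (hs : ∀ i, 0 ≤ s i)
    {z : Fin n → Ω → EuclideanSpace ℝ (Fin d)}
    (law : ∀ i, HasLaw (z i) (multivariateGaussian 0 (s i • 1)) P) (indep : iIndepFun z P)
    (v : Fin n → ℝ) {r : ℝ} (hv : ∑ i, s i * v i ^ 2 ≤ r) (hd : 0 < d) {t : ℝ} (ht : 0 ≤ t)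
    (htd : t ≤ 2 * d) :
    P.real {ω | r * t < |‖∑ i, v i • z i ω‖ ^ 2 - d * ∑ i, s i * v i ^ 2|} ≤
      2 * Real.exp (-(t ^ 2 / (16 * d))) := by
  have hz : ∀ i, AEMeasurable (z i) P := fun i ↦ (law i).aemeasurable
  have hmap := map_sum_smul_eq_map_stdGaussian hs law indep v
  set q : ℝ := ∑ i, s i * v i ^ 2
  have hq : 0 ≤ q := Finset.sum_nonneg fun i _ ↦ mul_nonneg (hs i) (sq_nonneg _)
  have hmeas : MeasurableSet {x : EuclideanSpace ℝ (Fin d) | r * t < |‖x‖ ^ 2 - d * q|} :=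
    measurableSet_lt (by fun_prop) (by fun_prop)
  have h1 : P.real {ω | r * t < |‖∑ i, v i • z i ω‖ ^ 2 - d * q|} =
      (P.map (fun ω ↦ ∑ i, v i • z i ω)).real {x | r * t < |‖x‖ ^ 2 - d * q|} := by
    rw [measureReal_def, measureReal_def, Measure.map_apply_of_aemeasurable (by fun_prop) hmeas]
    rfl
  rw [h1, hmap, map_measureReal_apply (by fun_prop) hmeas]
  refine le_trans (measureReal_mono fun x hx ↦ ?_) (stdGaussian_real_le_abs_norm_sq_sub hd ht htd)
  simp only [Set.mem_preimage, Set.mem_ofPred_eq, norm_smul, mul_pow, Real.norm_eq_abs, sq_abs,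
    Real.sq_sqrt hq] at hx ⊢
  rw [show q * ‖x‖ ^ 2 - d * q = q * (‖x‖ ^ 2 - d) by ring, abs_mul, abs_of_nonneg hq] at hx
  -- `q` may vanish, so there is no division by it; the strict inequality in the event supplies the
  -- contradiction.
  by_contra! hlt
  have := mul_le_mul_of_nonneg_left hlt.le hq
  have := mul_le_mul_of_nonneg_right hv ht
  linarith

lemma integral_inner_sq_multivariateGaussian {d : ℕ} {s : ℝ} (hs : 0 ≤ s)
    (a : EuclideanSpace ℝ (Fin d)) :
    ∫ x, inner ℝ a x ^ 2 ∂(multivariateGaussian 0 (s • (1 : Matrix (Fin d) (Fin d) ℝ))) =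
      s * ‖a‖ ^ 2 := by
  have hps : (s • (1 : Matrix (Fin d) (Fin d) ℝ)).PosSemidef := Matrix.PosSemidef.one.smul hs
  have h := covarianceBilin_multivariateGaussian (μ := 0) hps a a
  rw [covarianceBilin_self IsGaussian.memLp_two_id, variance_of_integral_eq_zero (by fun_prop)] at h
  · rw [h, Matrix.smul_mulVec, Matrix.one_mulVec, dotProduct_smul, EuclideanSpace.real_norm_sq_eq]
    simp [dotProduct, sq]
  · have := ContinuousLinearMap.integral_comp_id_comm
      (μ := multivariateGaussian 0 (s • (1 : Matrix (Fin d) (Fin d) ℝ)))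
      IsGaussian.integrable_id (innerSL ℝ a)
    rw [integral_id_multivariateGaussian, map_zero] at this
    exact this

lemma integrable_inner_sq_multivariateGaussian {d : ℕ} (S : Matrix (Fin d) (Fin d) ℝ)
    (a : EuclideanSpace ℝ (Fin d)) :
    Integrable (fun x ↦ inner ℝ a x ^ 2) (multivariateGaussian 0 S) :=
  (IsGaussian.memLp_two_id.const_inner a).integrable_sq

/-- Markov's inequality with second moments is enough for the cross term. -/
lemma measureReal_le_sum_inner_sq {n d : ℕ} {Ω : Type*} [MeasurableSpace Ω] {P : Measure Ω}
    [IsProbabilityMeasure P] {s : Fin n → ℝ} (hs : ∀ i, 0 ≤ s i) {b : ℝ} (hb : ∀ i, s i ≤ b)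
    {z : Fin n → Ω → EuclideanSpace ℝ (Fin d)}
    (law : ∀ i, HasLaw (z i) (multivariateGaussian 0 (s i • 1)) P)
    (a : EuclideanSpace ℝ (Fin d)) {r : ℝ} (hr : 0 < r) :
    P.real {ω | r ≤ ∑ i, inner ℝ a (z i ω) ^ 2} ≤ b * n * ‖a‖ ^ 2 / r := by
  have hint : ∀ i, Integrable (fun ω ↦ inner ℝ a (z i ω) ^ 2) P := fun i ↦ by
    have := integrable_inner_sq_multivariateGaussian (s i • 1) a
    rw [← (law i).map_eq] at this
    exact this.comp_aemeasurable (law i).aemeasurable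
  have hval : ∀ i, ∫ ω, inner ℝ a (z i ω) ^ 2 ∂P = s i * ‖a‖ ^ 2 := fun i ↦ by
    rw [← integral_inner_sq_multivariateGaussian (hs i) a]
    exact (law i).integral_comp (f := fun x ↦ inner ℝ a x ^ 2) (by fun_prop)
  have hm := mul_meas_ge_le_integral_of_nonneg (μ := P)
    (f := fun ω ↦ ∑ i, inner ℝ a (z i ω) ^ 2)
    (ae_of_all _ fun ω ↦ Finset.sum_nonneg fun i _ ↦ sq_nonneg _)
    (integrable_finsetSum _ fun i _ ↦ hint i) r
  rw [integral_finsetSum _ fun i _ ↦ hint i, Finset.sum_congr rfl fun i _ ↦ hval i] at hm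
  rw [le_div_iff₀ hr, mul_comm]
  refine hm.trans ?_
  rw [← Finset.sum_mul]
  refine mul_le_mul_of_nonneg_right ?_ (sq_nonneg _)
  refine (Finset.sum_le_sum fun i _ ↦ hb i).trans (le_of_eq ?_)
  simp [mul_comm]

/-! ### Nets of the unit ball -/

/-- A 1-separated subset of the ball of radius 2 with maximal cardinality is a 1-net there, as an
uncovered point could be added; halving it gives the net. The volume bound on separated sets gives
`5 ^ finrank`. -/
lemma exists_finset_half_net (E : Type*) [NormedAddCommGroup E] [NormedSpace ℝ E]
    [FiniteDimensional ℝ E] :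
    ∃ N : Finset E, N.card ≤ 5 ^ Module.finrank ℝ E ∧ (∀ c ∈ N, ‖c‖ ≤ 1) ∧
      ∀ x : E, ‖x‖ ≤ 1 → ∃ c ∈ N, ‖x - c‖ ≤ 1 / 2 := by
  classical
  let S : Set ℕ := {k | ∃ M : Finset E, M.card = k ∧ (∀ c ∈ M, ‖c‖ ≤ 2) ∧
    ∀ c ∈ M, ∀ e ∈ M, c ≠ e → 1 ≤ ‖c - e‖}
  have hS : BddAbove S := ⟨5 ^ Module.finrank ℝ E, by
    rintro _ ⟨M, rfl, h1, h2⟩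
    exact Besicovitch.card_le_of_separated M h1 h2⟩
  have hne : S.Nonempty := ⟨0, ∅, by simp⟩
  obtain ⟨M, hcard, h1, h2⟩ := Nat.sSup_mem hne hS
  refine ⟨M.image fun c ↦ (1 / 2 : ℝ) • c,
    Finset.card_image_le.trans (Besicovitch.card_le_of_separated M h1 h2), ?_, fun x hx ↦ ?_⟩
  · simp only [Finset.mem_image]
    rintro _ ⟨c, hc, rfl⟩
    have := h1 c hc
    rw [norm_smul, Real.norm_of_nonneg (by norm_num)]
    linarith
  · have hx2 : ‖(2 : ℝ) • x‖ ≤ 2 := by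
      rw [norm_smul, Real.norm_of_nonneg (by norm_num)]; linarith
    obtain ⟨c, hc, hcx⟩ : ∃ c ∈ M, ‖(2 : ℝ) • x - c‖ ≤ 1 := by
      by_contra! hcon
      have hnot : (2 : ℝ) • x ∉ M := fun h ↦ by
        have := hcon _ h
        simp at this
        linarith
      have hmem : M.card + 1 ∈ S := by
        refine ⟨insert ((2 : ℝ) • x) M, Finset.card_insert_of_notMem hnot, ?_, ?_⟩
        · simp only [Finset.mem_insert, forall_eq_or_imp]
          exact ⟨hx2, h1⟩
        · simp only [Finset.mem_insert, forall_eq_or_imp]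
          refine ⟨⟨fun h ↦ absurd rfl h, fun e he _ ↦ (hcon e he).le⟩, fun c hc ↦
            ⟨fun _ ↦ ?_, h2 c hc⟩⟩
          rw [norm_sub_rev]
          exact (hcon c hc).le
      have := le_csSup hS hmem
      omega
    refine ⟨_, Finset.mem_image_of_mem _ hc, ?_⟩
    have : x - (1 / 2 : ℝ) • c = (1 / 2 : ℝ) • ((2 : ℝ) • x - c) := by
      rw [smul_sub, smul_smul]; norm_num
    rw [this, norm_smul, Real.norm_of_nonneg (by norm_num)]
    linarith

lemma abs_le_two_mul_of_half_net {E : Type*} [NormedAddCommGroup E] [NormedSpace ℝ E]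
    [FiniteDimensional ℝ E] {N : Finset E}
    (hN : ∀ x : E, ‖x‖ ≤ 1 → ∃ c ∈ N, ‖x - c‖ ≤ 1 / 2) (f : E →ₗ[ℝ] ℝ) {b : ℝ}
    (hf : ∀ c ∈ N, |f c| ≤ b) {x : E} (hx : ‖x‖ ≤ 1) : |f x| ≤ 2 * b := by
  let g : E →L[ℝ] ℝ := LinearMap.toContinuousLinearMap f
  have hb : 0 ≤ b := by
    obtain ⟨c, hc, -⟩ := hN 0 (by simp)
    exact (abs_nonneg _).trans (hf c hc)
  have hg : ‖g‖ ≤ b + ‖g‖ * (1 / 2) := by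
    refine ContinuousLinearMap.opNorm_le_of_unit_norm (by positivity) fun y hy ↦ ?_
    obtain ⟨c, hc, hyc⟩ := hN y hy.le
    calc ‖g y‖ = ‖g c + g (y - c)‖ := by rw [← map_add]; simp
      _ ≤ ‖g c‖ + ‖g (y - c)‖ := norm_add_le _ _
      _ ≤ b + ‖g‖ * (1 / 2) := add_le_add (hf c hc) (g.le_opNorm_of_le hyc)
  have := g.le_opNorm_of_le hx
  change ‖f x‖ ≤ _ at this
  rw [Real.norm_eq_abs] at this
  linarith

/-- Polarization by half-sums and half-differences, which stay in the unit ball, costs a factor 2;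
passing from the net to the ball costs 2 in each variable. -/
lemma abs_bilin_le_of_half_net {E : Type*} [NormedAddCommGroup E] [NormedSpace ℝ E]
    [FiniteDimensional ℝ E] {N : Finset E}
    (hN : ∀ x : E, ‖x‖ ≤ 1 → ∃ c ∈ N, ‖x - c‖ ≤ 1 / 2) (B : E →ₗ[ℝ] E →ₗ[ℝ] ℝ)
    (hB : ∀ v w, B v w = B w v) {b : ℝ}
    (hadd : ∀ c ∈ N, ∀ e ∈ N, |B ((1 / 2 : ℝ) • (c + e)) ((1 / 2 : ℝ) • (c + e))| ≤ b)
    (hsub : ∀ c ∈ N, ∀ e ∈ N, |B ((1 / 2 : ℝ) • (c - e)) ((1 / 2 : ℝ) • (c - e))| ≤ b)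
    {v w : E} (hv : ‖v‖ ≤ 1) (hw : ‖w‖ ≤ 1) : |B v w| ≤ 8 * b := by
  have h1 : ∀ c ∈ N, ∀ e ∈ N, |B c e| ≤ 2 * b := fun c hc e he ↦ by
    have : B c e = B ((1 / 2 : ℝ) • (c + e)) ((1 / 2 : ℝ) • (c + e)) -
        B ((1 / 2 : ℝ) • (c - e)) ((1 / 2 : ℝ) • (c - e)) := by
      simp only [map_smul, map_add, map_sub, LinearMap.smul_apply, LinearMap.add_apply,
        LinearMap.sub_apply, smul_eq_mul, hB e c]
      ring
    rw [this]
    refine (abs_sub _ _).trans ?_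
    linarith [hadd c hc e he, hsub c hc e he]
  have h2 : ∀ c ∈ N, |B c w| ≤ 2 * (2 * b) := fun c hc ↦
    abs_le_two_mul_of_half_net hN (B c) (h1 c hc) hw
  have h3 := abs_le_two_mul_of_half_net hN (B.flip w) (fun c hc ↦ by simpa using h2 c hc) hv
  simp only [LinearMap.flip_apply] at h3
  linarith

/-! ### The noise Gram matrix -/

/-- The bilinear form of `Z Zᵀ - d • diag s`, where `Z` is the matrix with rows `z i`. -/
noncomputable def centeredGramForm {n d : ℕ} (s : Fin n → ℝ)
    (z : Fin n → EuclideanSpace ℝ (Fin d)) :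
    EuclideanSpace ℝ (Fin n) →ₗ[ℝ] EuclideanSpace ℝ (Fin n) →ₗ[ℝ] ℝ :=
  LinearMap.mk₂ ℝ
    (fun v w ↦ inner ℝ (∑ i, v i • z i) (∑ i, w i • z i) - d * ∑ i, s i * (v i * w i))
    (fun a b c ↦ by
      simp only [PiLp.add_apply, add_smul, Finset.sum_add_distrib, inner_add_left, add_mul, mul_add]
      ring)
    (fun r a c ↦ by
      simp only [PiLp.smul_apply, smul_eq_mul, mul_smul, ← Finset.smul_sum, inner_smul_left]
      simp only [conj_trivial, mul_sub, Finset.mul_sum]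
      congr 1
      exact Finset.sum_congr rfl fun i _ ↦ by ring)
    (fun a b c ↦ by
      simp only [PiLp.add_apply, add_smul, Finset.sum_add_distrib, inner_add_right, mul_add]
      ring)
    (fun r a c ↦ by
      simp only [PiLp.smul_apply, smul_eq_mul, mul_smul, ← Finset.smul_sum, inner_smul_right]
      simp only [mul_sub, Finset.mul_sum]
      congr 1
      exact Finset.sum_congr rfl fun i _ ↦ by ring)

lemma centeredGramForm_apply {n d : ℕ} (s : Fin n → ℝ) (z : Fin n → EuclideanSpace ℝ (Fin d))
    (v w : EuclideanSpace ℝ (Fin n)) :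
    centeredGramForm s z v w =
      inner ℝ (∑ i, v i • z i) (∑ i, w i • z i) - d * ∑ i, s i * (v i * w i) := rfl

lemma centeredGramForm_comm {n d : ℕ} (s : Fin n → ℝ) (z : Fin n → EuclideanSpace ℝ (Fin d))
    (v w : EuclideanSpace ℝ (Fin n)) : centeredGramForm s z v w = centeredGramForm s z w v := by
  simp only [centeredGramForm_apply, real_inner_comm, mul_comm]

/-- Union bound over the at most `5 ^ n * 5 ^ n` pairs of net points, each contributing a half-sum
and a half-difference event. -/
lemma measureReal_not_abs_centeredGramForm_le {n d : ℕ} {Ω : Type*} [MeasurableSpace Ω]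
    {P : Measure Ω} [IsProbabilityMeasure P] {s : Fin n → ℝ} (hs : ∀ i, 0 ≤ s i) {b : ℝ}
    (hb0 : 0 ≤ b) (hb : ∀ i, s i ≤ b) {z : Fin n → Ω → EuclideanSpace ℝ (Fin d)}
    (law : ∀ i, HasLaw (z i) (multivariateGaussian 0 (s i • 1)) P) (indep : iIndepFun z P)
    (hd : 0 < d) {t : ℝ} (ht : 0 ≤ t) (htd : t ≤ 2 * d) :
    P.real {ω | ¬ ∀ v w : EuclideanSpace ℝ (Fin n), ‖v‖ ≤ 1 → ‖w‖ ≤ 1 →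
      |centeredGramForm s (fun i ↦ z i ω) v w| ≤ 8 * (b * t)} ≤
      25 ^ n * (4 * Real.exp (-(t ^ 2 / (16 * d)))) := by
  obtain ⟨N, hcard, hN1, hN⟩ := exists_finset_half_net (EuclideanSpace ℝ (Fin n))
  rw [finrank_euclideanSpace_fin] at hcard
  let A : EuclideanSpace ℝ (Fin n) → Set Ω := fun v ↦
    {ω | b * t < |centeredGramForm s (fun i ↦ z i ω) v v|}
  have hA : ∀ v, ‖v‖ ≤ 1 → P.real (A v) ≤ 2 * Real.exp (-(t ^ 2 / (16 * d))) := fun v hv ↦ by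
    have hvb : ∑ i, s i * v i ^ 2 ≤ b := by
      calc ∑ i, s i * v i ^ 2 ≤ ∑ i, b * v i ^ 2 :=
            Finset.sum_le_sum fun i _ ↦ mul_le_mul_of_nonneg_right (hb i) (sq_nonneg _)
        _ = b * ‖v‖ ^ 2 := by rw [← Finset.mul_sum, EuclideanSpace.real_norm_sq_eq]
        _ ≤ b * 1 := by gcongr; exact pow_le_one₀ (norm_nonneg _) hv
        _ = b := mul_one b
    have := measureReal_lt_abs_norm_sum_smul_sq_sub hs law indep v hvb hd ht htd
    simpa only [A, centeredGramForm_apply, real_inner_self_eq_norm_sq, ← sq] using this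
  have hsub : {ω | ¬ ∀ v w : EuclideanSpace ℝ (Fin n), ‖v‖ ≤ 1 → ‖w‖ ≤ 1 →
      |centeredGramForm s (fun i ↦ z i ω) v w| ≤ 8 * (b * t)} ⊆
      ⋃ p ∈ N ×ˢ N, A ((1 / 2 : ℝ) • (p.1 + p.2)) ∪ A ((1 / 2 : ℝ) • (p.1 - p.2)) := by
    intro ω hω
    by_contra hcon
    simp only [Set.mem_iUnion, Finset.mem_product, not_exists, Set.mem_union, not_or, A,
      Set.mem_ofPred_eq, not_lt] at hcon
    exact hω fun v w hv hw ↦ abs_bilin_le_of_half_net hN _ (centeredGramForm_comm _ _)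
      (fun c hc e he ↦ (hcon (c, e) ⟨hc, he⟩).1) (fun c hc e he ↦ (hcon (c, e) ⟨hc, he⟩).2) hv hw
  have hhalf : ∀ x y : EuclideanSpace ℝ (Fin n), ‖x‖ ≤ 1 → ‖y‖ ≤ 1 →
      ‖(1 / 2 : ℝ) • (x + y)‖ ≤ 1 := fun x y hx hy ↦ by
    have := norm_add_le x y
    rw [norm_smul, Real.norm_of_nonneg (by norm_num)]
    linarith
  refine (measureReal_mono hsub (measure_ne_top _ _)).trans ((measureReal_biUnion_finset_le _ _).trans ?_)
  refine (Finset.sum_le_card_nsmul _ _ (4 * Real.exp (-(t ^ 2 / (16 * d)))) fun p hp ↦ ?_).trans ?_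
  · obtain ⟨h1, h2⟩ := Finset.mem_product.1 hp
    refine (measureReal_union_le _ _).trans ?_
    have e1 := hA _ (hhalf p.1 p.2 (hN1 _ h1) (hN1 _ h2))
    have e2 := hA _ (hhalf p.1 (-p.2) (hN1 _ h1) (by simpa using hN1 _ h2))
    rw [← sub_eq_add_neg] at e2
    linarith
  · rw [nsmul_eq_mul, Finset.card_product]
    refine mul_le_mul_of_nonneg_right ?_ (by positivity)
    have : N.card * N.card ≤ 25 ^ n := by
      calc N.card * N.card ≤ 5 ^ n * 5 ^ n := Nat.mul_le_mul hcard hcard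
        _ = 25 ^ n := by rw [← mul_pow]; norm_num
    exact_mod_cast this

/-! ### Leading eigenvectors and quadratic forms -/

/-- Rayleigh principle, by expansion in an orthonormal eigenbasis. -/
lemma IsLeadingEigenvector.inner_le {n : ℕ} {A : Matrix (Fin n) (Fin n) ℝ} (hA : A.IsHermitian)
    {w : EuclideanSpace ℝ (Fin n)} (hw : IsLeadingEigenvector A w)
    {v : EuclideanSpace ℝ (Fin n)} (hv : ‖v‖ = 1) :
    inner ℝ v (Matrix.toEuclideanLin A v) ≤ inner ℝ w (Matrix.toEuclideanLin A w) := by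
  obtain ⟨hw1, l, hl, hmax⟩ := hw
  have hT : (Matrix.toEuclideanLin A).IsSymmetric := Matrix.isSymmetric_toEuclideanLin_iff.2 hA
  have hn : Module.finrank ℝ (EuclideanSpace ℝ (Fin n)) = n := finrank_euclideanSpace_fin
  have hwl : inner ℝ w (Matrix.toEuclideanLin A w) = l := by
    rw [hl.apply_eq_smul, inner_smul_right, real_inner_self_eq_norm_sq, hw1]; simp
  set b := hT.eigenvectorBasis hn
  rw [hwl, ← b.repr.inner_map_map, PiLp.inner_apply]
  calc ∑ i, inner ℝ (b.repr v i) (b.repr (Matrix.toEuclideanLin A v) i)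
      = ∑ i, hT.eigenvalues hn i * (b.repr v i) ^ 2 := by
        refine Finset.sum_congr rfl fun i _ ↦ ?_
        rw [hT.eigenvectorBasis_apply_self_apply hn v i]
        simp [b]
        ring
    _ ≤ ∑ i, l * (b.repr v i) ^ 2 := Finset.sum_le_sum fun i _ ↦
        mul_le_mul_of_nonneg_right (hmax _ (hT.hasEigenvalue_eigenvalues hn i)) (sq_nonneg _)
    _ = l := by
        rw [← Finset.mul_sum, ← EuclideanSpace.real_norm_sq_eq, b.repr.norm_map, hv]; simp

/-- If the quadratic form of `A` is within `δ` of `a ⟪p, v⟫² + c` on the unit sphere, then a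
leading eigenvector of `A` is almost aligned with `p`. -/
lemma IsLeadingEigenvector.one_sub_inner_sq_le {n : ℕ} {A : Matrix (Fin n) (Fin n) ℝ}
    (hA : A.IsHermitian) {w p : EuclideanSpace ℝ (Fin n)} (hw : IsLeadingEigenvector A w)
    (hp : ‖p‖ = 1) {a c δ : ℝ} (ha : 0 < a)
    (hQ : ∀ v : EuclideanSpace ℝ (Fin n), ‖v‖ = 1 →
      |inner ℝ v (Matrix.toEuclideanLin A v) - (a * inner ℝ p v ^ 2 + c)| ≤ δ) :
    1 - inner ℝ p w ^ 2 ≤ 2 * δ / a := by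
  -- `a + c - δ ≤ Q p ≤ Q w ≤ a * ⟪p, w⟫ ^ 2 + c + δ`, where `Q` is the form of `A`; the offset `c`
  -- cancels.
  have h1 := hw.inner_le hA hp
  have h2 := (abs_le.1 (hQ p hp)).1
  have h3 := (abs_le.1 (hQ w hw.1)).2
  rw [real_inner_self_eq_norm_sq, hp] at h2
  rw [le_div_iff₀ ha]
  linarith

lemma isHermitian_gram {n d : ℕ} (x : Fin n → EuclideanSpace ℝ (Fin d)) :
    (gram x).IsHermitian := by
  simpa [gram] using Matrix.isHermitian_mul_conjTranspose_self (dataMatrix x)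

lemma isHermitian_hollow {n : ℕ} {A : Matrix (Fin n) (Fin n) ℝ} (hA : A.IsHermitian) :
    (hollow A).IsHermitian := by
  ext i j
  have := hA.apply i j
  simp only [star_trivial] at this
  by_cases h : i = j
  · subst h; simp [hollow]
  · simp [hollow, h, Ne.symm h, this]

lemma gram_apply {n d : ℕ} (x : Fin n → EuclideanSpace ℝ (Fin d)) (i j : Fin n) :
    gram x i j = inner ℝ (x i) (x j) := by
  simp [gram, dataMatrix, Matrix.mul_apply, PiLp.inner_apply, mul_comm]

lemma inner_toEuclideanLin {n : ℕ} (A : Matrix (Fin n) (Fin n) ℝ)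
    (v : EuclideanSpace ℝ (Fin n)) :
    inner ℝ v (Matrix.toEuclideanLin A v) = ∑ i, ∑ j, v i * v j * A i j := by
  simp only [PiLp.inner_apply, Matrix.toLpLin_apply, Matrix.mulVec, dotProduct,
    RCLike.inner_apply, conj_trivial, Finset.sum_mul]
  exact Finset.sum_congr rfl fun i _ ↦ Finset.sum_congr rfl fun j _ ↦ by ring

lemma inner_toEuclideanLin_gram {n d : ℕ} (x : Fin n → EuclideanSpace ℝ (Fin d))
    (v : EuclideanSpace ℝ (Fin n)) :
    inner ℝ v (Matrix.toEuclideanLin (gram x) v) = ‖∑ i, v i • x i‖ ^ 2 := by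
  rw [inner_toEuclideanLin, ← real_inner_self_eq_norm_sq, sum_inner]
  refine Finset.sum_congr rfl fun i _ ↦ ?_
  rw [inner_sum]
  refine Finset.sum_congr rfl fun j _ ↦ ?_
  rw [gram_apply, real_inner_smul_left, real_inner_smul_right, mul_assoc]

lemma inner_toEuclideanLin_hollow {n : ℕ} (A : Matrix (Fin n) (Fin n) ℝ)
    (v : EuclideanSpace ℝ (Fin n)) :
    inner ℝ v (Matrix.toEuclideanLin (hollow A) v) =
      inner ℝ v (Matrix.toEuclideanLin A v) - ∑ i, v i ^ 2 * A i i := by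
  rw [inner_toEuclideanLin, inner_toEuclideanLin, ← Finset.sum_sub_distrib]
  refine Finset.sum_congr rfl fun i _ ↦ ?_
  have h : v i ^ 2 * A i i = ∑ j, if i = j then v i * v j * A i j else 0 := by
    simp [sq]
  rw [h, ← Finset.sum_sub_distrib]
  refine Finset.sum_congr rfl fun j _ ↦ ?_
  by_cases hij : i = j <;> simp [hollow, hij]

/-! ### The normalized sign vector -/

/-- The vector `y / √n`. -/
noncomputable def unitSign {n : ℕ} (y : Fin n → ℝ) : EuclideanSpace ℝ (Fin n) :=
  (√n)⁻¹ • WithLp.toLp 2 y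

lemma norm_unitSign {n : ℕ} (hn : 1 ≤ n) {y : Fin n → ℝ} (hy : ∀ i, y i = 1 ∨ y i = -1) :
    ‖unitSign y‖ = 1 := by
  have h1 : ‖(WithLp.toLp 2 y : EuclideanSpace ℝ (Fin n))‖ = √n := by
    rw [EuclideanSpace.norm_eq]
    congr 1
    rw [Finset.sum_congr rfl fun i _ ↦ show ‖y i‖ ^ 2 = 1 by rcases hy i with h | h <;> simp [h]]
    simp
  have : 0 < √(n : ℝ) := Real.sqrt_pos.2 (by exact_mod_cast hn)
  rw [unitSign, norm_smul, h1, Real.norm_of_nonneg (by positivity), inv_mul_cancel₀ this.ne']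

lemma sum_mul_sign_eq {n : ℕ} (hn : 1 ≤ n) (y : Fin n → ℝ) (v : EuclideanSpace ℝ (Fin n)) :
    ∑ i, v i * y i = √n * inner ℝ (unitSign y) v := by
  have : 0 < √(n : ℝ) := Real.sqrt_pos.2 (by exact_mod_cast hn)
  rw [unitSign, real_inner_smul_left, ← mul_assoc, mul_inv_cancel₀ this.ne', one_mul,
    PiLp.inner_apply]
  simp

lemma sum_smul_signal_add {n d : ℕ} (hn : 1 ≤ n) (y : Fin n → ℝ) (μ : EuclideanSpace ℝ (Fin d))
    (z : Fin n → EuclideanSpace ℝ (Fin d)) (v : EuclideanSpace ℝ (Fin n)) :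
    ∑ i, v i • (signal y μ i + z i) =
      (√n * inner ℝ (unitSign y) v) • μ + ∑ i, v i • z i := by
  simp only [signal, smul_add, smul_smul, Finset.sum_add_distrib, ← sum_mul_sign_eq hn,
    Finset.sum_smul]

lemma eq_or_eq_neg_of_one_sub_inner_sq_nonpos {E : Type*} [NormedAddCommGroup E]
    [InnerProductSpace ℝ E] {p w : E} (hp : ‖p‖ = 1) (hw : ‖w‖ = 1)
    (h : 1 - inner ℝ p w ^ 2 ≤ 0) : w = p ∨ w = -p := by
  have h1 : |inner ℝ p w| ≤ 1 := by simpa [hp, hw] using abs_real_inner_le_norm p w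
  have h2 : (inner ℝ p w) ^ 2 = 1 := le_antisymm ((sq_le_one_iff_abs_le_one _).2 h1) (by linarith)
  rcases (sq_eq_sq_iff_eq_or_eq_neg.1 (h2.trans (one_pow 2).symm)) with h | h
  · exact Or.inl ((inner_eq_one_iff_of_norm_eq_one hp hw).1 h).symm
  · right
    have : inner ℝ p (-w) = 1 := by rw [inner_neg_right, h]; norm_num
    have := (inner_eq_one_iff_of_norm_eq_one hp (by rwa [norm_neg])).1 this
    rw [this, neg_neg]

lemma IsLeadingEigenvector.eq_unitSign {n d : ℕ} (hn : 1 ≤ n) {y : Fin n → ℝ}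
    (hy : ∀ i, y i = 1 ∨ y i = -1) {μ : EuclideanSpace ℝ (Fin d)} (hμ : μ ≠ 0)
    {w : EuclideanSpace ℝ (Fin n)} (hw : IsLeadingEigenvector (gram (signal y μ)) w) :
    w = unitSign y ∨ w = -unitSign y := by
  have hn' : (0 : ℝ) < n := by exact_mod_cast hn
  have hμ' : 0 < ‖μ‖ := norm_pos_iff.2 hμ
  have := hw.one_sub_inner_sq_le (isHermitian_gram _) (norm_unitSign hn hy)
    (a := n * ‖μ‖ ^ 2) (c := 0) (δ := 0) (by positivity) fun v _ ↦ by
      have h := sum_smul_signal_add hn y μ 0 v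
      simp only [Pi.zero_apply, add_zero, smul_zero, Finset.sum_const_zero] at h
      rw [inner_toEuclideanLin_gram, h, norm_smul, mul_pow, Real.norm_eq_abs, sq_abs, mul_pow,
        Real.sq_sqrt hn'.le]
      apply le_of_eq
      rw [abs_eq_zero]
      ring
  exact eq_or_eq_neg_of_one_sub_inner_sq_nonpos (norm_unitSign hn hy) hw.1 (by simpa using this)

/-! ### Deterministic perturbation bounds -/

/-- The variances `2` for the first sample and `1` for all the others. -/
def firstDoubledVar (n : ℕ) : Fin n → ℝ := fun i ↦ if (i : ℕ) = 0 then 2 else 1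

lemma firstDoubled_eq_smul_one (n d : ℕ) (i : Fin n) :
    firstDoubled n d i = firstDoubledVar n i • (1 : Matrix (Fin d) (Fin d) ℝ) := by
  unfold firstDoubled firstDoubledVar
  split_ifs <;> simp

lemma sum_firstDoubledVar_mul {n : ℕ} (hn : 1 ≤ n) {v : EuclideanSpace ℝ (Fin n)}
    (hv : ‖v‖ = 1) :
    ∑ i, firstDoubledVar n i * (v i * v i) =
      1 + inner ℝ (EuclideanSpace.single (⟨0, hn⟩ : Fin n) (1 : ℝ)) v ^ 2 := by
  have h : ∀ i : Fin n, firstDoubledVar n i * (v i * v i) =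
      v i ^ 2 + if i = ⟨0, hn⟩ then v i ^ 2 else 0 := fun i ↦ by
    simp only [firstDoubledVar, Fin.ext_iff]
    split_ifs <;> ring
  simp only [h, Finset.sum_add_distrib, Finset.sum_ite_eq', Finset.mem_univ, if_true]
  rw [← EuclideanSpace.real_norm_sq_eq, hv]
  simp [EuclideanSpace.inner_single_left]

lemma abs_inner_sum_smul_le {n d : ℕ} (μ : EuclideanSpace ℝ (Fin d))
    (z : Fin n → EuclideanSpace ℝ (Fin d)) {v : EuclideanSpace ℝ (Fin n)} (hv : ‖v‖ = 1) :
    |inner ℝ μ (∑ i, v i • z i)| ≤ √(∑ i, inner ℝ μ (z i) ^ 2) := by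
  refine Real.abs_le_sqrt ?_
  rw [inner_sum]
  simp only [real_inner_smul_right]
  refine (Finset.sum_mul_sq_le_sq_mul_sq _ _ _).trans ?_
  rw [← EuclideanSpace.real_norm_sq_eq, hv]
  simp

section Perturbation

variable {n d : ℕ} (hn : 1 ≤ n) {y : Fin n → ℝ} (hy : ∀ i, y i = 1 ∨ y i = -1)
  (μ : EuclideanSpace ℝ (Fin d)) (z : Fin n → EuclideanSpace ℝ (Fin d)) {β : ℝ}

include hn hy

lemma abs_cross_term_le {v : EuclideanSpace ℝ (Fin n)} (hv : ‖v‖ = 1) :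
    |2 * (√n * inner ℝ (unitSign y) v) * inner ℝ μ (∑ i, v i • z i)| ≤
      2 * √n * √(∑ i, inner ℝ μ (z i) ^ 2) := by
  have h1 : |inner ℝ (unitSign y) v| ≤ 1 := by
    simpa [norm_unitSign hn hy, hv] using abs_real_inner_le_norm (unitSign y) v
  rw [abs_mul, abs_mul, abs_mul, abs_two, abs_of_nonneg (Real.sqrt_nonneg _)]
  refine mul_le_mul ?_ (abs_inner_sum_smul_le μ z hv) (abs_nonneg _) (by positivity)
  have := mul_le_mul_of_nonneg_left h1 (Real.sqrt_nonneg (n : ℝ))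
  linarith

/-- Here the signal itself is counted as error: the noise variances dominate. -/
lemma abs_inner_gram_sub_le {s : Fin n → ℝ}
    (hβ : ∀ v w : EuclideanSpace ℝ (Fin n), ‖v‖ ≤ 1 → ‖w‖ ≤ 1 → |centeredGramForm s z v w| ≤ β)
    {v : EuclideanSpace ℝ (Fin n)} (hv : ‖v‖ = 1) :
    |inner ℝ v (Matrix.toEuclideanLin (gram fun i ↦ signal y μ i + z i) v) -
      d * ∑ i, s i * (v i * v i)| ≤
      n * ‖μ‖ ^ 2 + 2 * √n * √(∑ i, inner ℝ μ (z i) ^ 2) + β := by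
  have h1 : |inner ℝ (unitSign y) v| ≤ 1 := by
    simpa [norm_unitSign hn hy, hv] using abs_real_inner_le_norm (unitSign y) v
  have h2 := abs_cross_term_le hn hy μ z hv
  have h3 := hβ v v hv.le hv.le
  rw [inner_toEuclideanLin_gram, sum_smul_signal_add hn, norm_add_sq_real, norm_smul, mul_pow,
    Real.norm_eq_abs, sq_abs, mul_pow, Real.sq_sqrt (Nat.cast_nonneg n), real_inner_smul_left]
  rw [centeredGramForm_apply, real_inner_self_eq_norm_sq] at h3
  have h4 : inner ℝ (unitSign y) v ^ 2 ≤ 1 := (sq_le_one_iff_abs_le_one _).2 h1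
  have h5 : (n : ℝ) * inner ℝ (unitSign y) v ^ 2 * ‖μ‖ ^ 2 ≤ n * ‖μ‖ ^ 2 := by
    have := mul_le_mul_of_nonneg_left h4 (show 0 ≤ (n : ℝ) * ‖μ‖ ^ 2 by positivity)
    linarith
  have h6 : 0 ≤ (n : ℝ) * inner ℝ (unitSign y) v ^ 2 * ‖μ‖ ^ 2 := by positivity
  obtain ⟨h2a, h2b⟩ := abs_le.1 h2
  obtain ⟨h3a, h3b⟩ := abs_le.1 h3
  rw [abs_le]
  constructor <;> linarith

/-- The removed diagonal entries are `‖μ‖ ^ 2 + d * s i` up to error, so the `d * s i` cancel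
against the mean of `Z Zᵀ`. The form bound is used twice: at `v`, and at basis vectors for the
diagonal. -/
lemma abs_inner_hollow_gram_sub_le {s : Fin n → ℝ}
    (hβ : ∀ v w : EuclideanSpace ℝ (Fin n), ‖v‖ ≤ 1 → ‖w‖ ≤ 1 → |centeredGramForm s z v w| ≤ β)
    {v : EuclideanSpace ℝ (Fin n)} (hv : ‖v‖ = 1) :
    |inner ℝ v (Matrix.toEuclideanLin (hollow (gram fun i ↦ signal y μ i + z i)) v) -
      (n * ‖μ‖ ^ 2 * inner ℝ (unitSign y) v ^ 2 + -‖μ‖ ^ 2)| ≤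
      4 * √n * √(∑ i, inner ℝ μ (z i) ^ 2) + 2 * β := by
  set ρ := √(∑ i, inner ℝ μ (z i) ^ 2) with hρ
  have hρ0 : 0 ≤ ρ := Real.sqrt_nonneg _
  have hsum : ∑ i, v i ^ 2 = 1 := by rw [← EuclideanSpace.real_norm_sq_eq, hv]; simp
  have hn1 : 1 ≤ √(n : ℝ) := Real.one_le_sqrt.2 (by exact_mod_cast hn)
  have h2 := abs_cross_term_le hn hy μ z hv
  have h3 := hβ v v hv.le hv.le
  have hdiag : ∀ i, |gram (fun i ↦ signal y μ i + z i) i i - ‖μ‖ ^ 2 - d * s i| ≤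
      2 * ρ + β := fun i ↦ by
    have hz : |inner ℝ μ (z i)| ≤ ρ := Real.abs_le_sqrt
      (Finset.single_le_sum (f := fun i ↦ inner ℝ μ (z i) ^ 2) (fun i _ ↦ sq_nonneg _)
        (Finset.mem_univ i))
    have hb := hβ (EuclideanSpace.single i 1) (EuclideanSpace.single i 1) (by simp) (by simp)
    have hy1 : ‖y i‖ = 1 := by rcases hy i with h | h <;> simp [h]
    have hb' : centeredGramForm s z (EuclideanSpace.single i 1) (EuclideanSpace.single i 1) =
        ‖z i‖ ^ 2 - d * s i := by
      rw [centeredGramForm_apply, real_inner_self_eq_norm_sq]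
      simp [ite_smul]
    rw [hb'] at hb
    have hcr : |y i * inner ℝ μ (z i)| ≤ ρ := by
      rw [abs_mul, ← Real.norm_eq_abs, hy1, one_mul]; exact hz
    rw [gram_apply, real_inner_self_eq_norm_sq, norm_add_sq_real, signal, norm_smul, hy1,
      real_inner_smul_left, one_mul]
    obtain ⟨a1, a2⟩ := abs_le.1 hb
    obtain ⟨b1, b2⟩ := abs_le.1 hcr
    rw [abs_le]
    constructor <;> linarith
  have hD : |∑ i, v i ^ 2 * gram (fun i ↦ signal y μ i + z i) i i - ‖μ‖ ^ 2 -
      d * ∑ i, s i * (v i * v i)| ≤ 2 * ρ + β := by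
    have e : ∑ i, v i ^ 2 * gram (fun i ↦ signal y μ i + z i) i i - ‖μ‖ ^ 2 -
        d * ∑ i, s i * (v i * v i) =
        ∑ i, v i ^ 2 * (gram (fun i ↦ signal y μ i + z i) i i - ‖μ‖ ^ 2 - d * s i) := by
      simp only [mul_sub, Finset.sum_sub_distrib, ← Finset.sum_mul, hsum, one_mul, Finset.mul_sum]
      congr 1
      exact Finset.sum_congr rfl fun i _ ↦ by ring
    rw [e]
    refine (Finset.abs_sum_le_sum_abs _ _).trans ?_
    calc _ ≤ ∑ i, v i ^ 2 * (2 * ρ + β) := Finset.sum_le_sum fun i _ ↦ by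
          rw [abs_mul, abs_of_nonneg (sq_nonneg (v i))]
          exact mul_le_mul_of_nonneg_left (hdiag i) (sq_nonneg _)
      _ = 2 * ρ + β := by rw [← Finset.sum_mul, hsum, one_mul]
  rw [inner_toEuclideanLin_hollow, inner_toEuclideanLin_gram, sum_smul_signal_add hn,
    norm_add_sq_real, norm_smul, mul_pow, Real.norm_eq_abs, sq_abs, mul_pow,
    Real.sq_sqrt (Nat.cast_nonneg n), real_inner_smul_left]
  rw [centeredGramForm_apply, real_inner_self_eq_norm_sq] at h3
  -- Absorbs the `2 * ρ` of the diagonal into the cross-term error.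
  have h7 : ρ ≤ √n * ρ := le_mul_of_one_le_left hρ0 hn1
  obtain ⟨h2a, h2b⟩ := abs_le.1 h2
  obtain ⟨h3a, h3b⟩ := abs_le.1 h3
  obtain ⟨h4a, h4b⟩ := abs_le.1 hD
  rw [abs_le]
  constructor <;> linarith

end Perturbation

/-- Split `w` into its component along `e` and a remainder of squared norm `1 - ⟪e, w⟫ ^ 2`. -/
lemma abs_inner_le_add_sqrt {E : Type*} [NormedAddCommGroup E] [InnerProductSpace ℝ E]
    {e p w : E} (he : ‖e‖ = 1) (hp : ‖p‖ = 1) (hw : ‖w‖ = 1) {θ : ℝ}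
    (h : 1 - inner ℝ e w ^ 2 ≤ θ) : |inner ℝ w p| ≤ |inner ℝ e p| + √θ := by
  have hew : |inner ℝ e w| ≤ 1 := by simpa [he, hw] using abs_real_inner_le_norm e w
  have hnorm : ‖w - inner ℝ e w • e‖ ≤ √θ := by
    refine Real.le_sqrt_of_sq_le (le_trans (le_of_eq ?_) h)
    rw [norm_sub_sq_real, norm_smul, real_inner_smul_right, real_inner_comm, he, hw,
      mul_pow, Real.norm_eq_abs, sq_abs]
    ring
  have hsplit : inner ℝ w p = inner ℝ e w * inner ℝ e p + inner ℝ (w - inner ℝ e w • e) p := by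
    rw [inner_sub_left, real_inner_smul_left]; ring
  rw [hsplit]
  refine (abs_add_le _ _).trans (add_le_add ?_ ?_)
  · rw [abs_mul]; exact mul_le_of_le_one_left (abs_nonneg _) hew
  · refine (abs_real_inner_le_norm _ _).trans ?_
    rw [hp, mul_one]; exact hnorm

/-- Only monotonicity of the outer measure is used, so `Y n` and `E n` need not be measurable; the
eigenvectors are arbitrary choices. -/
lemma tendstoInProb_of_forall_notMem {Ω : ℕ → Type*} [∀ n, MeasurableSpace (Ω n)]
    {P : ∀ n, Measure (Ω n)} [∀ n, IsProbabilityMeasure (P n)] {Y : ∀ n, Ω n → ℝ} {c : ℝ}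
    (E : ∀ n, Set (Ω n)) {p b : ℕ → ℝ} (hp : ∀ᶠ n in atTop, (P n).real (E n) ≤ p n)
    (hp0 : Tendsto p atTop (𝓝 0)) (hb0 : Tendsto b atTop (𝓝 0))
    (hb : ∀ᶠ n in atTop, ∀ᵐ ω ∂(P n), ω ∉ E n → |Y n ω - c| ≤ b n) : TendstoInProb P Y c := by
  intro ε hε
  have hlim : Tendsto (fun n : ℕ ↦ ENNReal.ofReal (p n)) atTop (𝓝 0) := by
    simpa using ENNReal.tendsto_ofReal hp0
  refine tendsto_of_tendsto_of_tendsto_of_le_of_le' tendsto_const_nhds hlim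
    (Eventually.of_forall fun _ ↦ zero_le) ?_
  filter_upwards [hp, hb, hb0.eventually_lt_const hε] with n h1 h2 h3
  have h4 : P n {ω | ε ≤ |Y n ω - c|} ≤ P n (E n) := by
    refine measure_mono_ae ?_
    filter_upwards [h2] with ω hω hmem
    by_contra hnot
    exact absurd (le_trans (show ε ≤ |Y n ω - c| from hmem) (hω hnot)) (not_le.2 h3)
  refine h4.trans ?_
  rw [← ofReal_measureReal (μ := P n) (s := E n)]
  exact ENNReal.ofReal_le_ofReal h1

lemma tendsto_pow_mul_exp_neg :
    Tendsto (fun n : ℕ ↦ (25 : ℝ) ^ n * (4 * Real.exp (-(4 * n)))) atTop (𝓝 0) := by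
  have h25 : 25 * Real.exp (-4) < 1 := by
    have h1 := Real.exp_one_gt_d9
    have h2 : Real.exp 4 = Real.exp 1 ^ 4 := by rw [← Real.exp_nat_mul]; norm_num
    have h3 : (2.7 : ℝ) ^ 4 ≤ Real.exp 1 ^ 4 :=
      pow_le_pow_left₀ (by norm_num) (by linarith) 4
    rw [Real.exp_neg, ← div_eq_mul_inv, div_lt_one (Real.exp_pos _), h2]
    norm_num at h3
    linarith
  have := (tendsto_pow_atTop_nhds_zero_of_lt_one (by positivity) h25).const_mul 4
  rw [mul_zero] at this
  refine this.congr fun n ↦ ?_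
  rw [mul_pow, ← Real.exp_nat_mul]
  ring_nf

lemma sqrt_natCast_mul_eq {n d : ℕ} (hn : 0 < n) :
    √((n : ℝ) * d) = n * √((d : ℝ) / n) := by
  have hn' : (0 : ℝ) < n := by exact_mod_cast hn
  rw [← Real.sqrt_sq hn'.le, ← Real.sqrt_mul (by positivity), Real.sqrt_sq hn'.le]
  congr 1
  field_simp

/-! ### Consequences of the two growth conditions -/

section Asymptotics

variable {d : ℕ → ℕ} {m : ℕ → ℝ}
  (hlower : MuchLess (fun n ↦ ((d n : ℝ) / (n : ℝ)) ^ (1 / 4 : ℝ)) m)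
  (hupper : MuchLess m (fun n ↦ √((d n : ℝ) / (n : ℝ))))

include hlower hupper

lemma eventually_pos : ∀ᶠ n in atTop, 0 < n ∧ 0 < d n ∧ 0 < m n := by
  filter_upwards [hlower.1, hupper.1, eventually_gt_atTop 0] with n h1 h2 hn
  refine ⟨hn, Nat.pos_of_ne_zero fun h ↦ ?_, h1⟩
  simp [h] at h2

omit hupper in
lemma tendsto_sqrt_div_sq : Tendsto (fun n : ℕ ↦ √((d n : ℝ) / n) / m n ^ 2) atTop (𝓝 0) := by
  have := hlower.2.pow 2
  simp only [ne_eq, OfNat.ofNat_ne_zero, not_false_eq_true, zero_pow] at this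
  refine this.congr fun n ↦ ?_
  rw [div_pow, ← Real.rpow_natCast, ← Real.rpow_mul (by positivity), Real.sqrt_eq_rpow]
  norm_num

/-- `1 / m` is the product of `√(d / n) / m ^ 2` and `m / √(d / n)`, each tending to zero by one of
the two conditions. -/
lemma tendsto_inv_norm : Tendsto (fun n : ℕ ↦ (m n)⁻¹) atTop (𝓝 0) := by
  have := (tendsto_sqrt_div_sq hlower).mul hupper.2
  rw [mul_zero] at this
  refine this.congr' ?_
  filter_upwards [hupper.1, hlower.1] with n h1 h2
  field_simp

lemma tendsto_inv_sqrt_norm : Tendsto (fun n : ℕ ↦ (√(m n))⁻¹) atTop (𝓝 0) := by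
  have := (tendsto_inv_norm hlower hupper).sqrt
  simpa using this

lemma tendsto_inv_sqrt_ratio : Tendsto (fun n : ℕ ↦ (√((d n : ℝ) / n))⁻¹) atTop (𝓝 0) := by
  have := (tendsto_inv_norm hlower hupper).mul hupper.2
  rw [mul_zero] at this
  refine this.congr' ?_
  filter_upwards [hupper.1, hlower.1] with n h1 h2
  field_simp

lemma eventually_sixteen_mul_le : ∀ᶠ n : ℕ in atTop, 16 * (n : ℝ) ≤ d n := by
  filter_upwards [(tendsto_inv_sqrt_ratio hlower hupper).eventually_lt_const
    (show (0 : ℝ) < 1 / 4 by norm_num), hupper.1, eventually_gt_atTop 0] with n h1 h2 hn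
  have hn' : (0 : ℝ) < n := by exact_mod_cast hn
  rw [inv_lt_comm₀ h2 (by norm_num)] at h1
  have h3 : 4 ≤ √((d n : ℝ) / n) := by
    rw [one_div, inv_inv] at h1; exact h1.le
  rw [Real.le_sqrt (by norm_num) (by positivity), le_div_iff₀ hn'] at h3
  linarith

/-- The quotient equals `8 / √m + 512 * √(d / n) / m ^ 2`. -/
lemma tendsto_hollow_error :
    Tendsto (fun n : ℕ ↦ 2 * (4 * (n * (m n * √(m n))) + 2 * (128 * √((n : ℝ) * d n))) /
      (n * m n ^ 2)) atTop (𝓝 0) := by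
  have := ((tendsto_inv_sqrt_norm hlower hupper).const_mul 8).add
    ((tendsto_sqrt_div_sq hlower).const_mul 512)
  rw [mul_zero, mul_zero, add_zero] at this
  refine this.congr' ?_
  filter_upwards [eventually_pos hlower hupper] with n ⟨hn, _, hm⟩
  have hn' : (0 : ℝ) < n := by exact_mod_cast hn
  have hs : 0 < √(m n) := Real.sqrt_pos.2 hm
  have hinv : (√(m n))⁻¹ = √(m n) / m n := by
    rw [inv_eq_one_div, div_eq_div_iff hs.ne' hm.ne', one_mul, Real.mul_self_sqrt hm.le]
  rw [sqrt_natCast_mul_eq hn, hinv]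
  field_simp
  ring

lemma tendsto_gram_error :
    Tendsto (fun n : ℕ ↦ 2 * (n * m n ^ 2 + 2 * (n * (m n * √(m n))) + 128 * √((n : ℝ) * d n)) /
      d n) atTop (𝓝 0) := by
  have h2 := hupper.2.pow 2
  simp only [ne_eq, OfNat.ofNat_ne_zero, not_false_eq_true, zero_pow] at h2
  have := ((h2.const_mul 2).add ((h2.mul (tendsto_inv_sqrt_norm hlower hupper)).const_mul 4)).add
    ((tendsto_inv_sqrt_ratio hlower hupper).const_mul 256)
  simp only [mul_zero, add_zero] at this
  refine this.congr' ?_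
  filter_upwards [eventually_pos hlower hupper, hupper.1] with n ⟨hn, hd, hm⟩ hg
  have hn' : (0 : ℝ) < n := by exact_mod_cast hn
  have hd' : (0 : ℝ) < d n := by exact_mod_cast hd
  have hs : 0 < √(m n) := Real.sqrt_pos.2 hm
  have hinv : (√(m n))⁻¹ = √(m n) / m n := by
    rw [inv_eq_one_div, div_eq_div_iff hs.ne' hm.ne', one_mul, Real.mul_self_sqrt hm.le]
  have hinv' : (√((d n : ℝ) / n))⁻¹ = √((d n : ℝ) / n) / (d n / n) := by
    rw [inv_eq_one_div, div_eq_div_iff hg.ne' (by positivity), one_mul,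
      Real.mul_self_sqrt (by positivity)]
  rw [sqrt_natCast_mul_eq hn, hinv, hinv', div_pow, Real.sq_sqrt (by positivity)]
  field_simp
  ring

end Asymptotics

/-! ### The bad event -/

/-- The event that the noise Gram matrix is far from its mean, or that the noise is strongly
correlated with the signal. -/
def badEvent {n d : ℕ} {Ω : Type*} (μ : EuclideanSpace ℝ (Fin d))
    (z : Fin n → Ω → EuclideanSpace ℝ (Fin d)) : Set Ω :=
  {ω | ¬ ∀ v w : EuclideanSpace ℝ (Fin n), ‖v‖ ≤ 1 → ‖w‖ ≤ 1 →
    -- `t = 8 * √(n * d)` makes `t ^ 2 / (16 * d) = 4 * n`, and `exp (-4 * n)` beats `25 ^ n`; the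
    -- inner 2 bounds the variances, the outer 8 is the net constant.
    |centeredGramForm (firstDoubledVar n) (fun i ↦ z i ω) v w| ≤ 8 * (2 * (8 * √((n : ℝ) * d)))} ∪
  -- The exponent 3 lies between 2, so that Markov's bound `2 / ‖μ‖` vanishes, and 4, so that the
  -- cross term is `o(n ‖μ‖ ^ 2)`.
  {ω | n * ‖μ‖ ^ 3 ≤ ∑ i, inner ℝ μ (z i ω) ^ 2}

lemma measureReal_badEvent_le {n d : ℕ} {Ω : Type*} [MeasurableSpace Ω] {P : Measure Ω}
    [IsProbabilityMeasure P] {y : Fin n → ℝ} {μ : EuclideanSpace ℝ (Fin d)}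
    {z x : Fin n → Ω → EuclideanSpace ℝ (Fin d)}
    (h : IsRankOneGaussianModel P y μ (firstDoubled n d) z x) (hn : 0 < n) (hd : 0 < d)
    (hμ : 0 < ‖μ‖) (hnd : 16 * (n : ℝ) ≤ d) :
    P.real (badEvent μ z) ≤ 25 ^ n * (4 * Real.exp (-(4 * n))) + 2 * ‖μ‖⁻¹ := by
  have hn' : (0 : ℝ) < n := by exact_mod_cast hn
  have hd' : (0 : ℝ) < d := by exact_mod_cast hd
  have hs0 : ∀ i, 0 ≤ firstDoubledVar n i := fun i ↦ by
    unfold firstDoubledVar; split_ifs <;> norm_num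
  have hs2 : ∀ i, firstDoubledVar n i ≤ 2 := fun i ↦ by
    unfold firstDoubledVar; split_ifs <;> norm_num
  have law : ∀ i, HasLaw (z i) (multivariateGaussian 0 (firstDoubledVar n i • 1)) P := fun i ↦ by
    rw [← firstDoubled_eq_smul_one]; exact h.law i
  have htd : 8 * √((n : ℝ) * d) ≤ 2 * d := by
    have : √((n : ℝ) * d) ≤ d / 4 := Real.sqrt_le_iff.2 ⟨by positivity, by nlinarith⟩
    linarith
  have e1 := measureReal_not_abs_centeredGramForm_le hs0 zero_le_two hs2 law h.indep hd
    (t := 8 * √((n : ℝ) * d)) (by positivity) htd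
  have e2 := measureReal_le_sum_inner_sq hs0 hs2 law μ (r := n * ‖μ‖ ^ 3) (by positivity)
  have e3 : (8 * √((n : ℝ) * d)) ^ 2 / (16 * d) = 4 * n := by
    rw [mul_pow, Real.sq_sqrt (by positivity)]; field_simp; norm_num
  have e4 : 2 * n * ‖μ‖ ^ 2 / (n * ‖μ‖ ^ 3) = 2 * ‖μ‖⁻¹ := by field_simp
  rw [e3] at e1
  rw [e4] at e2
  exact (measureReal_union_le _ _).trans (add_le_add e1 e2)

lemma bounds_of_notMem_badEvent {n d : ℕ} {Ω : Type*} {μ : EuclideanSpace ℝ (Fin d)}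
    {z : Fin n → Ω → EuclideanSpace ℝ (Fin d)} {ω : Ω} (h : ω ∉ badEvent μ z) :
    (∀ v w : EuclideanSpace ℝ (Fin n), ‖v‖ ≤ 1 → ‖w‖ ≤ 1 →
      |centeredGramForm (firstDoubledVar n) (fun i ↦ z i ω) v w| ≤ 128 * √((n : ℝ) * d)) ∧
    √n * √(∑ i, inner ℝ μ (z i ω) ^ 2) ≤ n * (‖μ‖ * √‖μ‖) := by
  simp only [badEvent, Set.mem_union, Set.mem_ofPred_eq, not_or, not_not, not_le] at h
  refine ⟨fun v w hv hw ↦ (h.1 v w hv hw).trans (by linarith), ?_⟩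
  rw [← Real.sqrt_mul (Nat.cast_nonneg n)]
  refine Real.sqrt_le_iff.2 ⟨by positivity, ?_⟩
  rw [mul_pow, mul_pow, Real.sq_sqrt (norm_nonneg μ)]
  have := mul_le_mul_of_nonneg_left h.2.le (Nat.cast_nonneg (α := ℝ) n)
  linarith

end HollowedPCA


/-! ### Proof of the theorem -/

theorem mainTheorem12
    (d : ℕ → ℕ)
    {Ω : ℕ → Type*} [∀ n, MeasurableSpace (Ω n)]
    (P : ∀ n, Measure (Ω n)) [∀ n, IsProbabilityMeasure (P n)]
    (y : ∀ n, Fin n → ℝ)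
    (μ : ∀ n, EuclideanSpace ℝ (Fin (d n)))
    (z x : ∀ n, Fin n → Ω n → EuclideanSpace ℝ (Fin (d n)))
    (hmodel : ∀ n, HollowedPCA.IsRankOneGaussianModel (P n) (y n) (μ n)
      (HollowedPCA.firstDoubled n (d n)) (z n) (x n))
    (hlower : HollowedPCA.MuchLess (fun n => ((d n : ℝ) / (n : ℝ)) ^ (1 / 4 : ℝ))
      (fun n => ‖μ n‖))
    (hupper : HollowedPCA.MuchLess (fun n => ‖μ n‖)
      (fun n => Real.sqrt ((d n : ℝ) / (n : ℝ))))
    (ubar : ∀ n, EuclideanSpace ℝ (Fin n))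
    (hubar : ∀ n, 1 ≤ n → HollowedPCA.IsLeadingEigenvector
      (HollowedPCA.gram (HollowedPCA.signal (y n) (μ n))) (ubar n))
    (uhat u : ∀ n, Ω n → EuclideanSpace ℝ (Fin n))
    (huhat : ∀ n, 1 ≤ n → ∀ᵐ ω ∂(P n), HollowedPCA.IsLeadingEigenvector
      (HollowedPCA.gram (fun i => x n i ω)) (uhat n ω))
    (hu : ∀ n, 1 ≤ n → ∀ᵐ ω ∂(P n), HollowedPCA.IsLeadingEigenvector
      (HollowedPCA.hollow (HollowedPCA.gram (fun i => x n i ω))) (u n ω)) :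
    HollowedPCA.TendstoInProb P (fun n ω => |inner ℝ (uhat n ω) (ubar n)|) 0 ∧
    HollowedPCA.TendstoInProb P (fun n ω => |inner ℝ (u n ω) (ubar n)|) 1 := by
  have hbad : ∀ᶠ n in atTop, (P n).real (HollowedPCA.badEvent (μ n) (z n)) ≤
      25 ^ n * (4 * Real.exp (-(4 * n))) + 2 * ‖μ n‖⁻¹ := by
    filter_upwards [HollowedPCA.eventually_pos hlower hupper,
      HollowedPCA.eventually_sixteen_mul_le hlower hupper] with n ⟨hn, hd, hm⟩ h16
    exact HollowedPCA.measureReal_badEvent_le (hmodel n) hn hd hm h16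
  have hbad0 : Tendsto (fun n : ℕ ↦ (25 : ℝ) ^ n * (4 * Real.exp (-(4 * n))) + 2 * ‖μ n‖⁻¹)
      atTop (𝓝 0) := by
    simpa using HollowedPCA.tendsto_pow_mul_exp_neg.add
      ((HollowedPCA.tendsto_inv_norm hlower hupper).const_mul 2)
  have hinner : ∀ n, 1 ≤ n → μ n ≠ 0 → ∀ v : EuclideanSpace ℝ (Fin n),
      |inner ℝ v (ubar n)| = |inner ℝ v (HollowedPCA.unitSign (y n))| := fun n hn hμ v ↦ by
    rcases (hubar n hn).eq_unitSign hn (hmodel n).sign hμ with h | h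
    · rw [h]
    · rw [h, inner_neg_right, abs_neg]
  have hx : ∀ n ω, (fun i ↦ x n i ω) =
      fun i ↦ HollowedPCA.signal (y n) (μ n) i + z n i ω := fun n ω ↦
    funext fun i ↦ (hmodel n).eq i ω
  constructor
  -- The first summand `√(1 / n)` is the overlap of the first basis vector with `y / √n`.
  · have hlim := (tendsto_inv_atTop_nhds_zero_nat (𝕜 := ℝ)).sqrt.add
      (HollowedPCA.tendsto_gram_error hlower hupper).sqrt
    rw [Real.sqrt_zero, add_zero] at hlim
    refine HollowedPCA.tendstoInProb_of_forall_notMem _ hbad hbad0 hlim ?_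
    filter_upwards [HollowedPCA.eventually_pos hlower hupper] with n ⟨hn, hd, hm⟩
    filter_upwards [huhat n hn] with ω hω hgood
    obtain ⟨hβ, hW⟩ := HollowedPCA.bounds_of_notMem_badEvent hgood
    have hy := (hmodel n).sign
    have he : ‖EuclideanSpace.single (⟨0, hn⟩ : Fin n) (1 : ℝ)‖ = 1 := by simp
    rw [sub_zero, abs_abs, hinner n hn (norm_pos_iff.1 hm)]
    rw [hx] at hω
    have halign := hω.one_sub_inner_sq_le (HollowedPCA.isHermitian_gram _) he
      (a := d n) (c := d n)
      (δ := n * ‖μ n‖ ^ 2 + 2 * (n * (‖μ n‖ * √‖μ n‖)) + 128 * √((n : ℝ) * d n)) (by exact_mod_cast hd) fun v hv ↦ by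
        have := HollowedPCA.abs_inner_gram_sub_le hn hy (μ n) (fun i ↦ z n i ω) hβ hv
        rw [HollowedPCA.sum_firstDoubledVar_mul hn hv, mul_one_add, add_comm (d n : ℝ)] at this
        exact this.trans (by linarith)
    refine (HollowedPCA.abs_inner_le_add_sqrt he (HollowedPCA.norm_unitSign hn hy) hω.1
      halign).trans (add_le_add ?_ le_rfl)
    rw [EuclideanSpace.inner_single_left]
    rcases hy ⟨0, hn⟩ with h | h <;> simp [HollowedPCA.unitSign, h, abs_of_nonneg]
  · refine HollowedPCA.tendstoInProb_of_forall_notMem _ hbad hbad0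
      (HollowedPCA.tendsto_hollow_error hlower hupper) ?_
    filter_upwards [HollowedPCA.eventually_pos hlower hupper] with n ⟨hn, hd, hm⟩
    filter_upwards [hu n hn] with ω hω hgood
    obtain ⟨hβ, hW⟩ := HollowedPCA.bounds_of_notMem_badEvent hgood
    have hy := (hmodel n).sign
    have hn' : (0 : ℝ) < n := by exact_mod_cast hn
    rw [hinner n hn (norm_pos_iff.1 hm)]
    rw [hx] at hω
    have hp := HollowedPCA.norm_unitSign hn hy
    have halign := hω.one_sub_inner_sq_le
      (HollowedPCA.isHermitian_hollow (HollowedPCA.isHermitian_gram _)) hp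
      (a := n * ‖μ n‖ ^ 2) (c := -‖μ n‖ ^ 2)
      (δ := 4 * (n * (‖μ n‖ * √‖μ n‖)) + 2 * (128 * √((n : ℝ) * d n))) (by positivity) fun v hv ↦ by
        exact (HollowedPCA.abs_inner_hollow_gram_sub_le hn hy (μ n) (fun i ↦ z n i ω) hβ
          hv).trans (by linarith)
    have h1 : |inner ℝ (u n ω) (HollowedPCA.unitSign (y n))| ≤ 1 := by
      simpa [hω.1, hp] using abs_real_inner_le_norm (u n ω) (HollowedPCA.unitSign (y n))
    -- `1 - |a| ≤ 1 - a ^ 2` whenever `|a| ≤ 1`.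
    refine le_trans ?_ halign
    rw [abs_sub_comm, abs_of_nonneg (sub_nonneg.2 h1), real_inner_comm, ← sq_abs]
    rw [real_inner_comm] at h1
    nlinarith [abs_nonneg (inner ℝ (HollowedPCA.unitSign (y n)) (u n ω))]
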